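/- **Theorem 2.6 (Continuous Herbrand Theorem).** We use continuous first-order logic for metric structures. A signature $\mathcal L$ consists of function symbols and predicate symbols of finite arity, each with a modulus of uniform continuity $\Delta:(0,1]\to(0,1]$ (constant symbols are $0$-ary function symbols). An $\mathcal L$-structure $\mathcal M$ is a nonempty complete metric space $(M,d)$ of diameter at most $1$ together with interpretations $f^{\mathcal M}:M^k\to M$ and $P^{\mathcal M}:M^k\to[0,1]$ of the symbols which respect their moduli: $d(\vec u,\vec v)<\Delta(\eta)$ implies $d(f^{\mathcal M}(\vec u),f^{\mathcal M}(\vec v))\le\eta$, respectively $|P^{\mathcal M}(\vec u)-P^{\mathcal M}(\vec v)|\le\eta$ (with the maximum metric on $M^k$). Formulas are built from the atomic formulas $d(s,t)$ and $P(t_1,\ldots,t_k)$, where $s,t,t_i$ are terms, by means of all continuous connectives $[0,1]^k\to[0,1]$ and the quantifiers $\sup_x$, $\inf_x$. A theory $T$ is a set of closed conditions $\sigma=0$, where $\sigma$ is a sentence, and $\mathcal M\models T$ means that $\sigma^{\mathcal M}=0$ for each of these conditions. Let $T$ be an $\mathcal L$-theory such that 1. $T$ is complete: $T$ has a model, and every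 sentence has the same value in all models of $T$; 2. $T$ has quantifier elimination: for every $\mathcal L$-formula $\psi(z_1,\ldots,z_l)$ and every $\delta>0$ there is a quantifier-free $\mathcal L$-formula $\chi(z_1,\ldots,z_l)$ such that $|\psi^{\mathcal M}(\vec c)-\chi^{\mathcal M}(\vec c)|\le\delta$ for all $\mathcal M\models T$ and all $\vec c\in M^l$; 3. $T$ has a universal axiomatization: there is a set $\Gamma$ of conditions of the form $\sup_{\vec z}\theta(\vec z)=0$ with $\theta$ quantifier-free such that $T$ and $\Gamma$ have the same models. Let $\vec x=(x_1,\ldots,x_m)$ and $\vec y=(y_1,\ldots,y_n)$, where $m\ge 1$ or $\mathcal L$ has at least one constant symbol. Then for every $\mathcal L$-formula $\varphi(\vec x,\vec y)$ and every $\epsilon>0$ there are $k\ge 1$ and $\mathcal L$-terms $$t_{11}(\vec x),\ldots,t_{1n}(\vec x),\ \ldots,\ t_{k1}(\vec x),\ldots,t_{kn}(\vec x)$$ such that, for every $\mathcal M\models T$ and every $\vec a\in M^m$, if $\bigl(\inf_{\vec y}\varphi\bigr)^{\mathcal M}(\vec a)=0$, then $$\min_{1\le i\le k}\varphi^{\mathcal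 M}\bigl(\vec a,t_{i1}^{\mathcal M}(\vec a),\ldots,t_{in}^{\mathcal M}(\vec a)\bigr)\le\epsilon .$$ -/

import Mathlib

universe u v w

/-- A (one-sorted) signature for continuous logic. Every function symbol and every predicate
symbol has a finite arity and a modulus of uniform continuity `(0,1] → (0,1]`. Constant symbols
are the function symbols of arity `0`. As usual, the metric is bounded by `1` and all predicates
take values in `[0,1]`, so no further data are needed. -/
structure ContSignature where
  Functions : ℕ → Type u
  Predicates : ℕ → Type v
  funModulus : ∀ {n : ℕ}, Functions n → Set.Ioc (0 : ℝ) 1 → Set.Ioc (0 : ℝ) 1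
  predModulus : ∀ {n : ℕ}, Predicates n → Set.Ioc (0 : ℝ) 1 → Set.Ioc (0 : ℝ) 1

namespace ContSignature

/-- Terms in the variables `x₀, …, xₙ₋₁`. -/
inductive Term (L : ContSignature.{u, v}) (n : ℕ) : Type u
  | var (i : Fin n) : Term L n
  | func {k : ℕ} (f : L.Functions k) (ts : Fin k → Term L n) : Term L n

/-- Formulas of continuous logic with free variables among `x₀, …, xₙ₋₁`. The connectives are all
continuous functions `[0,1]^k → [0,1]`; the quantifiers are `sup` and `inf`, and they bind the
last variable `xₙ` of a formula in `x₀, …, xₙ`. -/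
inductive Formula (L : ContSignature.{u, v}) : ℕ → Type (max u v)
  | dist {n : ℕ} (s t : Term L n) : Formula L n
  | pred {n k : ℕ} (P : L.Predicates k) (ts : Fin k → Term L n) : Formula L n
  | conn {n k : ℕ} (c : C(Fin k → unitInterval, unitInterval)) (φs : Fin k → Formula L n) :
      Formula L n
  | sup {n : ℕ} (φ : Formula L (n + 1)) : Formula L n
  | inf {n : ℕ} (φ : Formula L (n + 1)) : Formula L n

/-- A sentence is a formula without free variables. -/
abbrev Sentence (L : ContSignature.{u, v}) : Type (max u v) := L.Formula 0

/-- A theory is a set of closed conditions `σ = 0`; the condition `σ = 0` is represented by the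
sentence `σ`. -/
abbrev Theory (L : ContSignature.{u, v}) : Type (max u v) := Set L.Sentence

/-- A metric structure for `L`: a nonempty complete metric space of diameter at most `1` with
interpretations of the symbols that respect the moduli of uniform continuity. The distance
between tuples is the maximum of the distances between the entries (the metric that Mathlib puts
on `Fin n → carrier`). -/
structure Structure (L : ContSignature.{u, v}) where
  carrier : Type w
  [metricSpace : MetricSpace carrier]
  [completeSpace : CompleteSpace carrier]
  [nonempty : Nonempty carrier]
  dist_le_one : ∀ x y : carrier, Dist.dist x y ≤ 1
  funMap : ∀ {n : ℕ}, L.Functions n → (Fin n → carrier) → carrier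
  predMap : ∀ {n : ℕ}, L.Predicates n → (Fin n → carrier) → unitInterval
  funMap_modulus : ∀ {n : ℕ} (f : L.Functions n) (ε : Set.Ioc (0 : ℝ) 1)
    (x y : Fin n → carrier), Dist.dist x y < (L.funModulus f ε : ℝ) →
      Dist.dist (funMap f x) (funMap f y) ≤ (ε : ℝ)
  predMap_modulus : ∀ {n : ℕ} (P : L.Predicates n) (ε : Set.Ioc (0 : ℝ) 1)
    (x y : Fin n → carrier), Dist.dist x y < (L.predModulus P ε : ℝ) →
      Dist.dist (predMap P x) (predMap P y) ≤ (ε : ℝ)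

attribute [instance] Structure.metricSpace Structure.completeSpace Structure.nonempty

variable {L : ContSignature.{u, v}}

/-- The value `t^M(a)` of a term. -/
def Term.eval (M : Structure.{u, v, w} L) {n : ℕ} (a : Fin n → M.carrier) :
    L.Term n → M.carrier
  | .var i => a i
  | .func f ts => M.funMap f (fun j => (ts j).eval M a)

/-- The value `φ^M(a) ∈ [0,1]` of a formula. The supremum and infimum are those of `[0,1]`. -/
noncomputable def Formula.eval (M : Structure.{u, v, w} L) :
    {n : ℕ} → L.Formula n → (Fin n → M.carrier) → unitInterval
  | _, .dist s t, a =>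
      ⟨Dist.dist (s.eval M a) (t.eval M a), dist_nonneg, M.dist_le_one _ _⟩
  | _, .pred P ts, a => M.predMap P (fun j => (ts j).eval M a)
  | _, .conn c φs, a => c (fun j => (φs j).eval M a)
  | _, .sup φ, a => ⨆ b : M.carrier, φ.eval M (Fin.snoc a b)
  | _, .inf φ, a => ⨅ b : M.carrier, φ.eval M (Fin.snoc a b)

/-- A formula without quantifiers. -/
def Formula.IsQuantifierFree : {n : ℕ} → L.Formula n → Prop
  | _, .dist _ _ => True
  | _, .pred _ _ => True
  | _, .conn _ φs => ∀ j, (φs j).IsQuantifierFree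
  | _, .sup _ => False
  | _, .inf _ => False

/-- `sup_{y₁} ⋯ sup_{yₙ} φ(x, y₁, …, yₙ)`, where `x` has length `m`. -/
def Formula.sups {m : ℕ} : (n : ℕ) → L.Formula (m + n) → L.Formula m
  | 0, φ => φ
  | n + 1, φ => Formula.sups n (Formula.sup φ)

/-- `inf_{y₁} ⋯ inf_{yₙ} φ(x, y₁, …, yₙ)`, where `x` has length `m`. -/
def Formula.infs {m : ℕ} : (n : ℕ) → L.Formula (m + n) → L.Formula m
  | 0, φ => φ
  | n + 1, φ => Formula.infs n (Formula.inf φ)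

/-- A universal sentence: `sup_x φ(x)` with `φ` quantifier-free and `x` a finite tuple. -/
def Sentence.IsUniversal (σ : L.Sentence) : Prop :=
  ∃ (n : ℕ) (φ : L.Formula (0 + n)), φ.IsQuantifierFree ∧ σ = Formula.sups n φ

/-- `M ⊨ T`: every condition `σ = 0` of `T` is true in `M`. -/
def Structure.Models (M : Structure.{u, v, w} L) (T : L.Theory) : Prop :=
  ∀ σ ∈ T, Formula.eval M σ Fin.elim0 = 0

namespace Theory

/- The universe of models in the following definitions is `max u v w`, that is, an arbitrary
universe that is at least as large as that of the signature. -/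

/-- `T` is complete: it has a model, and all its models give the same value to every sentence
(equivalently, the closed conditions that follow from `T` are those true in some structure). -/
def IsComplete (T : L.Theory) : Prop :=
  (∃ M : Structure.{u, v, max u v w} L, M.Models T) ∧
    ∀ M N : Structure.{u, v, max u v w} L, M.Models T → N.Models T →
      ∀ σ : L.Sentence, Formula.eval M σ Fin.elim0 = Formula.eval N σ Fin.elim0

/-- `T` has quantifier elimination: every formula is, uniformly over all models of `T`,
approximated arbitrarily well by quantifier-free formulas in the same variables. -/
def HasQuantifierElimination (T : L.Theory) : Prop :=
  ∀ (n : ℕ) (φ : L.Formula n) (ε : ℝ), 0 < ε →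
    ∃ χ : L.Formula n, χ.IsQuantifierFree ∧
      ∀ M : Structure.{u, v, max u v w} L, M.Models T → ∀ a : Fin n → M.carrier,
        |(φ.eval M a : ℝ) - (χ.eval M a : ℝ)| ≤ ε

/-- `T` has a universal axiomatization: some set of universal conditions has the same models. -/
def HasUniversalAxiomatization (T : L.Theory) : Prop :=
  ∃ Γ : L.Theory, (∀ σ ∈ Γ, Sentence.IsUniversal σ) ∧
    ∀ M : Structure.{u, v, max u v w} L, M.Models T ↔ M.Models Γ

end Theory

end ContSignature

open Filter Topology

namespace ContSignature

/-! ### Continuity of terms and quantifier-free formulas -/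

section Continuity

variable {L : ContSignature.{u, v}}

/-! A compactness argument. If no finite set `S` of tuples of terms works, choose a counterexample
`(M S, a S)` for each `S` and an ultrafilter `U` containing all cones of finite sets. Inside the
ultraproduct, the closed substructure `N` generated by the class of `a` satisfies the universal
axioms, hence models `T`. Quantifier elimination and Łoś's theorem for quantifier-free formulas make
the infimum of `φ` small in `N`, so `φ` is small at some tuple of `N`. Terms are dense in `N`, so a
tuple `t` of terms nearly does as well. Łoś carries this back to `U`-almost all `M S`, including
some with `t ∈ S`: a contradiction. Only quantifier-free formulas need a transfer principle, so `N`
is built directly as a completion of the terms (`termModel`), without the full ultraproduct. -/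

theorem uniformContinuous_of_modulus {X Y : Type*} [PseudoMetricSpace X] [PseudoMetricSpace Y]
    (Δ : Set.Ioc (0 : ℝ) 1 → Set.Ioc (0 : ℝ) 1) {f : X → Y}
    (h : ∀ (ε : Set.Ioc (0 : ℝ) 1) (x y : X), dist x y < (Δ ε : ℝ) → dist (f x) (f y) ≤ (ε : ℝ)) :
    UniformContinuous f := by
  rw [Metric.uniformContinuous_iff]
  intro ε hε
  -- The modulus accepts only values in `(0,1]` and yields `≤`; halving restores `<`.
  have hη : min (ε / 2) 1 ∈ Set.Ioc (0 : ℝ) 1 := ⟨by positivity, min_le_right _ _⟩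
  refine ⟨Δ ⟨_, hη⟩, (Δ ⟨_, hη⟩).2.1, fun {x y} hxy => ?_⟩
  have h₁ := h ⟨_, hη⟩ x y hxy
  have h₂ : min (ε / 2) 1 ≤ ε / 2 := min_le_left _ _
  simp only at h₁
  linarith

theorem Structure.continuous_funMap (M : Structure.{u, v, w} L) {n : ℕ} (f : L.Functions n) :
    Continuous (M.funMap f) :=
  (uniformContinuous_of_modulus (L.funModulus f) (M.funMap_modulus f)).continuous

theorem Structure.continuous_predMap (M : Structure.{u, v, w} L) {n : ℕ} (P : L.Predicates n) :
    Continuous (M.predMap P) :=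
  (uniformContinuous_of_modulus (L.predModulus P) (M.predMap_modulus P)).continuous

theorem Term.continuous_eval (M : Structure.{u, v, w} L) {n : ℕ} (t : L.Term n) :
    Continuous fun a : Fin n → M.carrier => t.eval M a := by
  induction t with
  | var i => exact continuous_apply i
  | func f ts ih => exact (M.continuous_funMap f).comp (continuous_pi ih)

theorem Formula.IsQuantifierFree.continuous_eval (M : Structure.{u, v, w} L) {n : ℕ}
    {φ : L.Formula n} (hφ : φ.IsQuantifierFree) :
    Continuous fun a : Fin n → M.carrier => φ.eval M a := by
  induction φ with
  | dist s t => exact ((s.continuous_eval M).dist (t.continuous_eval M)).subtype_mk _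
  | pred P ts =>
    exact (M.continuous_predMap P).comp (continuous_pi fun j => (ts j).continuous_eval M)
  | conn c φs ih => exact c.continuous.comp (continuous_pi fun j => ih j (hφ j))
  | sup φ _ => exact hφ.elim
  | inf φ _ => exact hφ.elim

end Continuity

/-! ### Blocks of quantifiers -/

section Quantifiers

variable {L : ContSignature.{u, v}} (M : Structure.{u, v, w} L)

theorem Formula.sups_eval_eq_zero_iff {m : ℕ} (n : ℕ) (φ : L.Formula (m + n))
    (a : Fin m → M.carrier) :
    (Formula.sups n φ).eval M a = 0 ↔ ∀ b : Fin n → M.carrier, φ.eval M (Fin.append a b) = 0 := by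
  induction n with
  | zero =>
    refine ⟨fun h b => ?_, fun h => ?_⟩
    · rw [Subsingleton.elim b Fin.elim0, Fin.append_elim0]; exact h
    · have := h Fin.elim0
      rw [Fin.append_elim0] at this; exact this
  | succ n ih =>
    have key : ∀ b : Fin n → M.carrier, (Formula.sup φ : L.Formula (m + n)).eval M
        (Fin.append a b) = 0 ↔ ∀ c, φ.eval M (Fin.snoc (Fin.append a b) c) = 0 := fun b => by
      have : (0 : unitInterval) = ⊥ := rfl
      rw [this]
      exact iSup_eq_bot
    refine (ih (Formula.sup φ)).trans ⟨fun h b => ?_, fun h b => (key b).2 fun c => ?_⟩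
    · have := (key _).1 (h (Fin.init b)) (b (Fin.last n))
      rwa [← Fin.append_snoc, Fin.snoc_init_self] at this
    · rw [← Fin.append_snoc]; exact h _

/-- The inequality is strict because the infimum need not be attained. -/
theorem Formula.infs_eval_lt_iff {m : ℕ} (n : ℕ) (φ : L.Formula (m + n))
    (a : Fin m → M.carrier) (r : unitInterval) :
    (Formula.infs n φ).eval M a < r ↔ ∃ b : Fin n → M.carrier, φ.eval M (Fin.append a b) < r := by
  induction n with
  | zero =>
    refine ⟨fun h => ⟨Fin.elim0, ?_⟩, fun ⟨b, h⟩ => ?_⟩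
    · rw [Fin.append_elim0]; exact h
    · rw [Subsingleton.elim b Fin.elim0, Fin.append_elim0] at h; exact h
  | succ n ih =>
    have key : ∀ b : Fin n → M.carrier, (Formula.inf φ : L.Formula (m + n)).eval M
        (Fin.append a b) < r ↔ ∃ c, φ.eval M (Fin.snoc (Fin.append a b) c) < r := fun b =>
      iInf_lt_iff
    refine (ih (Formula.inf φ)).trans ⟨fun ⟨b, h⟩ => ?_, fun ⟨b, h⟩ => ?_⟩
    · obtain ⟨c, hc⟩ := (key b).1 h
      exact ⟨Fin.snoc b c, by rwa [Fin.append_snoc]⟩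
    · refine ⟨Fin.init b, (key _).2 ⟨b (Fin.last n), ?_⟩⟩
      rwa [← Fin.append_snoc, Fin.snoc_init_self]

end Quantifiers

/-- Simultaneous substitution of terms for the variables of a term. -/
def Term.subst {L : ContSignature.{u, v}} {n m : ℕ} (s : Fin n → L.Term m) : L.Term n → L.Term m
  | .var i => s i
  | .func f ts => .func f fun j => (ts j).subst s

theorem Term.eval_subst {L : ContSignature.{u, v}} (M : Structure.{u, v, w} L) {n m : ℕ}
    (s : Fin n → L.Term m) (a : Fin m → M.carrier) (t : L.Term n) :
    (t.subst s).eval M a = t.eval M fun j => (s j).eval M a := by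
  induction t with
  | var i => rfl
  | func f ts ih => simp only [Term.subst, Term.eval, ih]

/-- The limit along an ultrafilter of a family of points of the unit interval. -/
noncomputable def ultralimit {ι : Type*} (U : Ultrafilter ι) (f : ι → unitInterval) :
    unitInterval :=
  (U.map f).lim

theorem tendsto_ultralimit {ι : Type*} (U : Ultrafilter ι) (f : ι → unitInterval) :
    Tendsto f U (𝓝 (ultralimit U f)) :=
  (U.map f).le_nhds_lim

/-! ### Terms under the limit pseudometric -/

section TermModel

variable {L : ContSignature.{u, v}} {ι : Type*} {m : ℕ}

/-- The set of terms in `m` variables, to be equipped with the limit along `U` of the distances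
between the values of the terms at the tuples `a i`. -/
def LimitTerm (_U : Ultrafilter ι) (M : ι → Structure.{u, v, w} L)
    (_a : ∀ i, Fin m → (M i).carrier) : Type (max u v w) :=
  ULift.{max v w} (L.Term m)

variable (U : Ultrafilter ι) (M : ι → Structure.{u, v, w} L) (a : ∀ i, Fin m → (M i).carrier)

/-- A term as a point of the space of terms. -/
def LimitTerm.of (t : L.Term m) : LimitTerm U M a :=
  ULift.up t

/-- The distance between the values of two terms at `a i`. -/
def termDist (s t : L.Term m) (i : ι) : unitInterval :=
  ⟨dist (s.eval (M i) (a i)) (t.eval (M i) (a i)), dist_nonneg, (M i).dist_le_one _ _⟩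

noncomputable instance : PseudoMetricSpace (LimitTerm U M a) where
  dist s t := ultralimit U (termDist M a s.down t.down)
  dist_self s := by
    have h : termDist M a s.down s.down = fun _ => 0 := by
      funext i; exact Subtype.ext (dist_self _)
    have := tendsto_nhds_unique (tendsto_ultralimit U (termDist M a s.down s.down))
      (h ▸ tendsto_const_nhds)
    exact congrArg Subtype.val this
  dist_comm s t := by
    have h : termDist M a s.down t.down = termDist M a t.down s.down := by
      funext i; exact Subtype.ext (dist_comm _ _)
    rw [h]
  dist_triangle s t r := by
    have h := fun s t : L.Term m => (continuous_subtype_val.tendsto _).comp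
      (tendsto_ultralimit U (termDist M a s t))
    exact le_of_tendsto_of_tendsto' (h s.down r.down) ((h s.down t.down).add (h t.down r.down))
      fun i => dist_triangle _ _ _

theorem LimitTerm.tendsto_dist (s t : LimitTerm U M a) :
    Tendsto (fun i => dist (s.down.eval (M i) (a i)) (t.down.eval (M i) (a i))) U
      (𝓝 (dist s t)) :=
  (continuous_subtype_val.tendsto _).comp (tendsto_ultralimit U (termDist M a s.down t.down))

/-- The values of the tuple `x` of terms at `a i`. -/
def LimitTerm.vals {k : ℕ} (x : Fin k → LimitTerm U M a) (i : ι) : Fin k → (M i).carrier :=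
  fun j => (x j).down.eval (M i) (a i)

theorem LimitTerm.eventually_dist_lt {k : ℕ} {x y : Fin k → LimitTerm U M a} {r : ℝ}
    (h : dist x y < r) : ∀ᶠ i in (U : Filter ι),
      dist (LimitTerm.vals U M a x i) (LimitTerm.vals U M a y i) < r := by
  have hr : 0 < r := dist_nonneg.trans_lt h
  -- The distance of tuples is a maximum over finitely many entries, so it suffices to treat each
  -- entry.
  simp only [dist_pi_lt_iff hr, eventually_all] at h ⊢
  exact fun j => (LimitTerm.tendsto_dist U M a (x j) (y j)).eventually_lt_const (h j)

/-- The interpretation of a function symbol on terms. -/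
def LimitTerm.funMap {k : ℕ} (f : L.Functions k) (x : Fin k → LimitTerm U M a) :
    LimitTerm U M a :=
  LimitTerm.of U M a (.func f fun j => (x j).down)

/-- The interpretation of a predicate symbol on terms. -/
noncomputable def LimitTerm.predMap {k : ℕ} (P : L.Predicates k) (x : Fin k → LimitTerm U M a) :
    unitInterval :=
  ultralimit U fun i => (M i).predMap P (LimitTerm.vals U M a x i)

/-- The strict premise is an open condition, so it holds in `U`-almost all `M i`; the weak
conclusion is closed, so it survives the limit. -/
theorem LimitTerm.funMap_modulus {k : ℕ} (f : L.Functions k) (ε : Set.Ioc (0 : ℝ) 1)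
    (x y : Fin k → LimitTerm U M a) (h : dist x y < (L.funModulus f ε : ℝ)) :
    dist (LimitTerm.funMap U M a f x) (LimitTerm.funMap U M a f y) ≤ (ε : ℝ) :=
  le_of_tendsto (LimitTerm.tendsto_dist U M a _ _)
    ((LimitTerm.eventually_dist_lt U M a h).mono fun i hi => (M i).funMap_modulus f ε _ _ hi)

theorem LimitTerm.predMap_modulus {k : ℕ} (P : L.Predicates k) (ε : Set.Ioc (0 : ℝ) 1)
    (x y : Fin k → LimitTerm U M a) (h : dist x y < (L.predModulus P ε : ℝ)) :
    dist (LimitTerm.predMap U M a P x) (LimitTerm.predMap U M a P y) ≤ (ε : ℝ) :=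
  le_of_tendsto ((tendsto_ultralimit U _).dist (tendsto_ultralimit U _))
    ((LimitTerm.eventually_dist_lt U M a h).mono fun i hi => (M i).predMap_modulus P ε _ _ hi)

end TermModel

/-! ### Extending operations to the completion -/

section CompletionExtension

open UniformSpace

variable {α β : Type*} [PseudoMetricSpace α] [MetricSpace β] {k : ℕ}

theorem isometry_coe_pi :
    Isometry fun (x : Fin k → α) (j : Fin k) => (x j : Completion α) :=
  Isometry.piMap _ fun _ => Completion.coe_isometry

theorem isUniformInducing_coe_pi :
    IsUniformInducing fun (x : Fin k → α) (j : Fin k) => (x j : Completion α) :=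
  isometry_coe_pi.isUniformInducing

theorem denseRange_coe_pi :
    DenseRange fun (x : Fin k → α) (j : Fin k) => (x j : Completion α) :=
  DenseRange.piMap fun _ => Completion.denseRange_coe

/-- The continuous extension to the completion of a map of several variables. -/
noncomputable def completionExtend (f : (Fin k → α) → β) : (Fin k → Completion α) → β :=
  (isUniformInducing_coe_pi.isDenseInducing denseRange_coe_pi).extend f

theorem completionExtend_coe {f : (Fin k → α) → β} (hf : UniformContinuous f) (x : Fin k → α) :
    completionExtend f (fun j => (x j : Completion α)) = f x :=
  uniformly_extend_of_ind isUniformInducing_coe_pi denseRange_coe_pi hf x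

theorem continuous_completionExtend [CompleteSpace β] {f : (Fin k → α) → β} (hf : UniformContinuous f) :
    Continuous (completionExtend f) :=
  (uniformContinuous_uniformly_extend isUniformInducing_coe_pi denseRange_coe_pi hf).continuous

theorem completionExtend_modulus [CompleteSpace β] (Δ : Set.Ioc (0 : ℝ) 1 → Set.Ioc (0 : ℝ) 1)
    {f : (Fin k → α) → β}
    (h : ∀ (ε : Set.Ioc (0 : ℝ) 1) (x y : Fin k → α),
      dist x y < (Δ ε : ℝ) → dist (f x) (f y) ≤ (ε : ℝ))
    (ε : Set.Ioc (0 : ℝ) 1) (x y : Fin k → Completion α) (hxy : dist x y < (Δ ε : ℝ)) :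
    dist (completionExtend f x) (completionExtend f y) ≤ (ε : ℝ) := by
  have hf := uniformContinuous_of_modulus Δ h
  have hc := continuous_completionExtend hf
  by_contra! hlt
  -- Violating pairs form an open set, so if there is one, there is one from the dense subspace.
  have hopen : IsOpen {p : (Fin k → Completion α) × (Fin k → Completion α) |
      dist p.1 p.2 < (Δ ε : ℝ) ∧
        (ε : ℝ) < dist (completionExtend f p.1) (completionExtend f p.2)} :=
    (isOpen_lt (continuous_fst.dist continuous_snd) continuous_const).and
      (isOpen_lt continuous_const ((hc.comp continuous_fst).dist (hc.comp continuous_snd)))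
  obtain ⟨⟨p, q⟩, h₁, h₂⟩ := (denseRange_coe_pi.prodMap denseRange_coe_pi).exists_mem_open hopen
    ⟨(x, y), hxy, hlt⟩
  simp only [Prod.map, completionExtend_coe hf] at h₁ h₂
  exact absurd (h ε p q ((isometry_coe_pi.dist_eq p q).symm.trans_lt h₁)) (not_le.2 h₂)

end CompletionExtension

/-! ### The term model and Łoś's theorem -/

section TermModel

open UniformSpace

variable {L : ContSignature.{u, v}} {ι : Type*} {m : ℕ}
variable (U : Ultrafilter ι) (M : ι → Structure.{u, v, w} L) (a : ∀ i, Fin m → (M i).carrier)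

/-- The substructure of the ultraproduct of the `M i` that is generated by the class of `a`,
constructed as the completion of the space of terms. -/
noncomputable def termModel [Nonempty (L.Term m)] : Structure.{u, v, max u v w} L where
  carrier := Completion (LimitTerm U M a)
  nonempty := (inferInstance : Nonempty (L.Term m)).map fun t => (LimitTerm.of U M a t : Completion _)
  dist_le_one x y := by
    refine Completion.induction_on₂ x y (isClosed_le (by fun_prop) (by fun_prop)) fun s t => ?_
    rw [Completion.dist_eq]
    exact (ultralimit U (termDist M a s.down t.down)).2.2
  funMap f := completionExtend fun x => (LimitTerm.funMap U M a f x : Completion _)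
  predMap P := completionExtend (LimitTerm.predMap U M a P)
  funMap_modulus f := completionExtend_modulus (L.funModulus f) fun ε x y h => by
    rw [Completion.dist_eq]; exact LimitTerm.funMap_modulus U M a f ε x y h
  predMap_modulus P :=
    completionExtend_modulus (L.predModulus P) (LimitTerm.predMap_modulus U M a P)

variable [Nonempty (L.Term m)]

/-- The class of a term in the term model. -/
noncomputable def termModel.mk (t : L.Term m) : (termModel U M a).carrier :=
  (LimitTerm.of U M a t : Completion (LimitTerm U M a))

theorem termModel.denseRange_mk (n : ℕ) :
    DenseRange fun (s : Fin n → L.Term m) (j : Fin n) => termModel.mk U M a (s j) := by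
  have h : DenseRange (termModel.mk U M a) :=
    (Completion.denseRange_coe (α := LimitTerm U M a)).comp
      (f := LimitTerm.of U M a)
      (Function.Surjective.denseRange fun x => ⟨x.down, rfl⟩) (Completion.continuous_coe _)
  exact DenseRange.piMap fun _ => h

theorem termModel.eval_term {n : ℕ} (s : Fin n → L.Term m) (t : L.Term n) :
    t.eval (termModel U M a) (fun j => termModel.mk U M a (s j)) =
      termModel.mk U M a (t.subst s) := by
  induction t with
  | var i => rfl
  | func f ts ih =>
    simp only [Term.eval, ih]
    exact completionExtend_coe
      (f := fun x => (LimitTerm.funMap U M a f x : Completion (LimitTerm U M a)))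
      ((Completion.uniformContinuous_coe _).comp (uniformContinuous_of_modulus (L.funModulus f)
        (LimitTerm.funMap_modulus U M a f))) _

/-- Łoś's theorem for quantifier-free formulas in the term model. -/
theorem Formula.IsQuantifierFree.tendsto_eval {n : ℕ} {φ : L.Formula n}
    (hφ : φ.IsQuantifierFree) (s : Fin n → L.Term m) :
    Tendsto (fun i => φ.eval (M i) fun j => (s j).eval (M i) (a i)) U
      (𝓝 (φ.eval (termModel U M a) fun j => termModel.mk U M a (s j))) := by
  induction φ with
  | dist t r =>
    rw [tendsto_subtype_rng]
    simp only [Formula.eval, termModel.eval_term, ← Term.eval_subst]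
    have := LimitTerm.tendsto_dist U M a (.of U M a (t.subst s)) (.of U M a (r.subst s))
    rwa [← Completion.dist_eq] at this
  | pred P ts =>
    simp only [Formula.eval, termModel.eval_term, ← Term.eval_subst]
    have h : (termModel U M a).predMap P (fun j => termModel.mk U M a ((ts j).subst s)) =
        LimitTerm.predMap U M a P fun j => LimitTerm.of U M a ((ts j).subst s) :=
      completionExtend_coe (f := LimitTerm.predMap U M a P)
        (uniformContinuous_of_modulus (L.predModulus P) (LimitTerm.predMap_modulus U M a P)) _
    rw [h]
    exact tendsto_ultralimit U _
  | conn c φs ih =>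
    exact (c.continuous.tendsto _).comp (tendsto_pi_nhds.2 fun j => ih j (hφ j) s)
  | sup φ _ => exact hφ.elim
  | inf φ _ => exact hφ.elim

/-- Universal conditions are inherited by the term model. -/
theorem termModel.models_of_universal {Γ : L.Theory} (hΓ : ∀ σ ∈ Γ, Sentence.IsUniversal σ)
    (hM : ∀ i, (M i).Models Γ) : (termModel U M a).Models Γ := by
  intro σ hσ
  obtain ⟨n, θ, hθ, rfl⟩ := hΓ σ hσ
  rw [Formula.sups_eval_eq_zero_iff]
  suffices h : ∀ c, θ.eval (termModel U M a) c = 0 from fun b => h _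
  -- The zero set of `θ` is closed, so tuples of terms suffice; there the value is a limit of zeros.
  refine fun c => (termModel.denseRange_mk U M a (0 + n)).induction_on
    (p := fun c => θ.eval (termModel U M a) c = 0) c
    (isClosed_eq (hθ.continuous_eval _) continuous_const) fun s => ?_
  refine tendsto_nhds_unique (hθ.tendsto_eval U M a s) (tendsto_const_nhds.congr fun i => ?_)
  have := (Formula.sups_eval_eq_zero_iff (M i) n θ _).1 (hM i _ hσ)
    (fun j => (s (Fin.natAdd 0 j)).eval (M i) (a i))
  rw [← this]
  congr 1
  rw [← Fin.append_castAdd_natAdd (f := fun j => (s j).eval (M i) (a i))]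
  congr 1
  exact Subsingleton.elim _ _

end TermModel

/-- The compactness argument itself. -/
theorem exists_finset_terms {L : ContSignature.{u, v}} {T : L.Theory}
    (hqe : Theory.HasQuantifierElimination.{u, v, w} T)
    (huniv : Theory.HasUniversalAxiomatization.{u, v, w} T)
    {m : ℕ} [Nonempty (L.Term m)] (n : ℕ) (φ : L.Formula (m + n)) {ε : ℝ} (hε : 0 < ε) :
    ∃ S : Finset (Fin n → L.Term m),
      ∀ M : Structure.{u, v, max u v w} L, M.Models T → ∀ a : Fin m → M.carrier,
        (Formula.infs n φ).eval M a = 0 →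
          ∃ t ∈ S, (φ.eval M (Fin.append a fun j => (t j).eval M a) : ℝ) ≤ ε := by
  classical
  by_contra! hneg
  choose M hMT a ha hlt using hneg
  obtain ⟨Γ, hΓ, hTΓ⟩ := huniv
  let U : Ultrafilter (Finset (Fin n → L.Term m)) := Ultrafilter.of atTop
  let N := termModel U M a
  let e : Fin m → N.carrier := fun j => termModel.mk U M a (.var j)
  have hNT : N.Models T := (hTΓ N).2
    (termModel.models_of_universal U M a hΓ fun S => (hTΓ _).1 (hMT S))
  -- Error budget in `N`: `χ ≤ δ`, the infimum is below `3δ`, `φ < 3δ` at a witness, `ψ < 4δ`; back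
  -- in `M S`, `φ < 5δ`. The bound `3δ ≤ 1` makes `3δ` a point of `unitInterval`.
  obtain ⟨δ, hδ, hδε, hδ1⟩ : ∃ δ : ℝ, 0 < δ ∧ 5 * δ ≤ ε ∧ 3 * δ ≤ 1 :=
    ⟨min (ε / 5) (1 / 3), by positivity, by linarith [min_le_left (ε / 5) (1 / 3 : ℝ)],
      by linarith [min_le_right (ε / 5) (1 / 3 : ℝ)]⟩
  obtain ⟨χ, hχ, hχT⟩ := hqe _ (Formula.infs n φ) δ hδ
  obtain ⟨ψ, hψ, hψT⟩ := hqe _ φ δ hδ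
  have h₁ : (χ.eval N e : ℝ) ≤ δ :=
    le_of_tendsto ((continuous_subtype_val.tendsto _).comp (hχ.tendsto_eval U M a .var))
      (.of_forall fun S => by
        have h := abs_le.1 (hχT (M S) (hMT S) (a S))
        rw [ha S] at h
        have h0 : ((0 : unitInterval) : ℝ) = 0 := rfl
        change (χ.eval (M S) (a S) : ℝ) ≤ δ
        linarith)
  have h₂ : (Formula.infs n φ).eval N e < ⟨3 * δ, by positivity, hδ1⟩ := by
    refine Subtype.coe_lt_coe.1 ?_
    have h := abs_le.1 (hχT N hNT e)
    change ((Formula.infs n φ).eval N e : ℝ) < 3 * δ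
    linarith
  obtain ⟨b, hb⟩ := (Formula.infs_eval_lt_iff N n φ e _).1 h₂
  have hb' : (φ.eval N (Fin.append e b) : ℝ) < 3 * δ := hb
  have h₃ : (ψ.eval N (Fin.append e b) : ℝ) < 4 * δ := by
    have h := abs_le.1 (hψT N hNT (Fin.append e b))
    linarith
  have hcont : Continuous fun c : Fin n → N.carrier => (ψ.eval N (Fin.append e c) : ℝ) := by
    refine continuous_subtype_val.comp ((hψ.continuous_eval N).comp (continuous_pi fun j => ?_))
    refine Fin.addCases (fun j => ?_) (fun j => ?_) j
    · simpa only [Fin.append_left] using continuous_const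
    · simpa only [Fin.append_right] using continuous_apply j
  -- The witness `b` may be only a limit of terms; `ψ < 4δ` is open, so some tuple of terms
  -- satisfies it too.
  obtain ⟨t, ht⟩ := (termModel.denseRange_mk U M a n).exists_mem_open
    (isOpen_lt hcont continuous_const) ⟨b, h₃⟩
  have happ : ∀ {X : Type (max u v w)} (g : L.Term m → X),
      (fun j => g (Fin.append Term.var t j)) =
        Fin.append (fun j => g (.var j)) fun j => g (t j) := fun g => by
    funext j
    refine Fin.addCases (fun j => ?_) (fun j => ?_) j
    · simp only [Fin.append_left]
    · simp only [Fin.append_right]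
  have h₄ := (continuous_subtype_val.tendsto _).comp
    (hψ.tendsto_eval U M a (Fin.append Term.var t))
  rw [happ] at h₄
  have h₅ : ∀ᶠ S in (U : Filter (Finset (Fin n → L.Term m))), t ∈ S :=
    Ultrafilter.of_le atTop ((eventually_ge_atTop {t}).mono fun S => Finset.singleton_subset_iff.1)
  obtain ⟨S, hS, htS⟩ := ((h₄.eventually_lt_const ht).and h₅).exists
  simp only [Function.comp_apply, happ] at hS
  have h := abs_le.1 (hψT (M S) (hMT S) (Fin.append (a S) fun j => (t j).eval (M S) (a S)))
  have h' : (ψ.eval (M S) (Fin.append (a S) fun j => (t j).eval (M S) (a S)) : ℝ) < 4 * δ := hS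
  linarith [hlt S t htS]

end ContSignature

theorem theorem2p6 (L : ContSignature.{u, v}) (T : L.Theory)
    (hT : ContSignature.Theory.IsComplete.{u, v, w} T)
    (hqe : ContSignature.Theory.HasQuantifierElimination.{u, v, w} T)
    (huniv : ContSignature.Theory.HasUniversalAxiomatization.{u, v, w} T)
    (m n : ℕ) (hm : 0 < m ∨ Nonempty (L.Functions 0))
    (φ : L.Formula (m + n)) (ε : ℝ) (hε : 0 < ε) :
    ∃ (k : ℕ) (t : Fin (k + 1) → Fin n → L.Term m),
      ∀ M : ContSignature.Structure.{u, v, max u v w} L, M.Models T →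
        ∀ a : Fin m → M.carrier,
          (ContSignature.Formula.infs n φ).eval M a = 0 →
            Finset.univ.inf' Finset.univ_nonempty (fun i : Fin (k + 1) =>
              (φ.eval M (Fin.append a (fun j => (t i j).eval M a)) : ℝ)) ≤ ε := by
  have : Nonempty (L.Term m) := hm.elim (fun h => ⟨.var ⟨0, h⟩⟩) fun ⟨c⟩ => ⟨.func c Fin.elim0⟩
  obtain ⟨S, hS⟩ := ContSignature.exists_finset_terms.{u, v, w} hqe huniv n φ hε
  let t₀ : Fin n → L.Term m := fun _ => this.some
  -- `S` may be empty; the dummy tuple `t₀` in position `0` keeps the list nonempty.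
  refine ⟨S.card, Fin.cons t₀ fun i => (S.equivFin.symm i : Fin n → L.Term m),
    fun M hM a ha => ?_⟩
  obtain ⟨t, htS, ht⟩ := hS M hM a ha
  refine (Finset.inf'_le _ (Finset.mem_univ (S.equivFin ⟨t, htS⟩).succ)).trans ?_
  simpa only [Fin.cons_succ, Equiv.symm_apply_apply] using ht
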